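/- **Theorem 3.2.** Let $(\Omega,\mathcal F)$ be a measurable space and $T:\Omega\to\Omega$ a measurable map. Let $\Theta$ be a nonempty set of probabilities on $(\Omega,\mathcal F)$, put $\mathbb V(A)=\sup_{P\in\Theta}P(A)$ for $A\in\mathcal F$, and assume that $\Theta$ consists of all probabilities $P$ on $(\Omega,\mathcal F)$ with $P(A)\le\mathbb V(A)$ for every $A\in\mathcal F$. Let $\mathcal I=\{A\in\mathcal F: T^{-1}A=A\}$. Assume that $\mathbb V$ is - continuous: $\mathbb V(A_n)\to0$ whenever $A_n\in\mathcal F$ and $A_n\downarrow\emptyset$; - $T$-invariant: $\mathbb V(T^{-1}A)=\mathbb V(A)$ for all $A\in\mathcal F$; - $T$-ergodic: $\mathbb V(A)\in\{0,1\}$ for all $A\in\mathcal I$. Let $\Theta_0$ be the set of $T$-invariant members of $\Theta$, let $\Theta_*$ be the set of those members of $\Theta_0$ that are ergodic, and let $\mathbb E^0[\xi]=\sup_{P\in\Theta_0}E_P[\xi]$ for bounded measurable $\xi:\Omega\to\mathbb R$. Then $\Theta_0$ is nonempty, $\Theta_*=\{P_1,\dots,P_m\}$ is finite (with the $P_i$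 distinct), and there is a partition $\Omega=D_1\cup\dots\cup D_m$ into pairwise disjoint sets $D_i\in\mathcal I$ with $P_i(D_i)=1$, such that for every $P\in\Theta$ and every bounded measurable $\xi:\Omega\to\mathbb R$, for $P$-almost every $\omega$ the limit below exists and $$-\mathbb E^0[-\xi]\ \le\ \lim_{n\to\infty}\frac1n\sum_{k=0}^{n-1}\xi(T^k\omega)\ =\ \sum_{i=1}^m E_{P_i}[\xi]\,1_{D_i}(\omega)\ \le\ \mathbb E^0[\xi].$$ -/

import Mathlib

open MeasureTheory Filter Topology
open scoped ENNReal

namespace ErgodicCapacity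

variable {Ω : Type*} [MeasurableSpace Ω]

/-- The upper probability `𝕍(A) = sup_{P ∈ Θ} P(A)` of a family `Θ` of probabilities. -/
noncomputable def upperProb (Θ : Set (ProbabilityMeasure Ω)) (A : Set Ω) : ℝ≥0∞ :=
  ⨆ P ∈ Θ, (P : Measure Ω) A

/-- The set of all probabilities dominated by a set function `V` on the measurable sets. -/
def dominated (V : Set Ω → ℝ≥0∞) : Set (ProbabilityMeasure Ω) :=
  {P | ∀ A, MeasurableSet A → (P : Measure Ω) A ≤ V A}

/-- Continuity from above (at the empty set): `V (A n) → 0` whenever `A n ↓ ∅`. -/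
def IsContinuous (V : Set Ω → ℝ≥0∞) : Prop :=
  ∀ A : ℕ → Set Ω, (∀ n, MeasurableSet (A n)) → Antitone A → ⋂ n, A n = ∅ →
    Tendsto (fun n => V (A n)) atTop (𝓝 0)

/-- `V` is `T`-invariant: `V (T⁻¹ A) = V A` for all measurable `A`. -/
def IsInvariant (T : Ω → Ω) (V : Set Ω → ℝ≥0∞) : Prop :=
  ∀ A, MeasurableSet A → V A = V (T ⁻¹' A)

/-- The zero-one law for `V` on the σ-algebra of measurable sets `A` with `T⁻¹ A = A`. -/
def IsZeroOne (T : Ω → Ω) (V : Set Ω → ℝ≥0∞) : Prop :=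
  ∀ A, MeasurableSet[MeasurableSpace.invariants T] A → V A = 0 ∨ V A = 1

/-- The `T`-ergodic upper probabilities: continuous, `T`-invariant, and equal to `0` or `1` on
every invariant set. -/
structure IsErgodic (T : Ω → Ω) (V : Set Ω → ℝ≥0∞) : Prop where
  continuous : IsContinuous V
  invariant : IsInvariant T V
  zeroOne : IsZeroOne T V

/-- The `T`-invariant members of `Θ`. -/
def invariantPart (T : Ω → Ω) (Θ : Set (ProbabilityMeasure Ω)) : Set (ProbabilityMeasure Ω) :=
  {P ∈ Θ | MeasurePreserving T (P : Measure Ω) (P : Measure Ω)}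

/-- The ergodic (in particular `T`-invariant) members of `Θ`. -/
def ergodicPart (T : Ω → Ω) (Θ : Set (ProbabilityMeasure Ω)) : Set (ProbabilityMeasure Ω) :=
  {P ∈ Θ | Ergodic T (P : Measure Ω)}

/-- The upper expectation `sup_{P ∈ Θ} E_P[ξ]` with respect to `Θ`; it is only used for nonempty
`Θ` and bounded measurable `ξ`, where the supremum is that of a nonempty bounded set. -/
noncomputable def upperExp (Θ : Set (ProbabilityMeasure Ω)) (ξ : Ω → ℝ) : ℝ :=
  sSup ((fun P : ProbabilityMeasure Ω => ∫ ω, ξ ω ∂(P : Measure Ω)) '' Θ)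

end ErgodicCapacity

/-! Continuity and the zero-one law together leave room for only finitely many invariant pieces. In
an infinite decreasing chain of invariant sets with differences of positive capacity, each
difference would have capacity 1, which continuity forbids. Hence Ω splits into finitely many atoms
(`exists_finset_isAtom`).

Each atom D carries an invariant member of Θ (`exists_mem_invariantPart`): take P_n in Θ with P_n(D)
→ 1, average along orbits and pass to an ultrafilter limit. Continuity makes the limit countably
additive, and it lies in Θ because Θ contains every dominated probability. Indecomposability of D
makes this P ergodic, so Birkhoff's theorem holds P-a.e.

The set where the averages of ξ tend to E_P[ξ] is invariant and meets D in positive capacity, so it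
exhausts D up to capacity zero. Convergence therefore holds a.e. on D under every member of Θ,
invariant or not (`IsAtom.ae_tendsto_average`). Applied to indicators, this also shows that P is the
only invariant member of Θ living on D. -/

namespace ErgodicCapacity

/-! ### Invariant probabilities as limits of orbit averages -/

section Limits

theorem preimage_iterate_eq_self {Ω : Type*} {T : Ω → Ω} {A : Set Ω} (hA : T ⁻¹' A = A) (k : ℕ) :
    T^[k] ⁻¹' A = A := by
  induction k with
  | zero => simp
  | succ k ih => rw [Function.iterate_succ, Set.preimage_comp, ih, hA]

variable {Ω : Type*} [MeasurableSpace Ω] {V : Set Ω → ℝ≥0∞}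

/-- Limits along an ultrafilter of probabilities dominated by a continuous set function are again
such probabilities. -/
theorem exists_mem_dominated_tendsto (hV : IsContinuous V) (U : Ultrafilter ℕ)
    (P : ℕ → ProbabilityMeasure Ω) (hP : ∀ n, P n ∈ dominated V) :
    ∃ Q ∈ dominated V, ∀ A, MeasurableSet A →
      Tendsto (fun n => (P n : Measure Ω) A) U (𝓝 ((Q : Measure Ω) A)) := by
  have hlim : ∀ A : Set Ω, ∃ l : ℝ≥0∞, Tendsto (fun n => (P n : Measure Ω) A) U (𝓝 l) := by
    intro A
    obtain ⟨l, -, hl⟩ := (isCompact_univ (X := ℝ≥0∞)).ultrafilter_le_nhds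
      (U.map fun n => (P n : Measure Ω) A) (by simp)
    exact ⟨l, hl⟩
  choose q hq using hlim
  have hq_empty : q ∅ = 0 := tendsto_nhds_unique (hq ∅) (by simp)
  have hq_univ : q Set.univ = 1 := tendsto_nhds_unique (hq Set.univ) (by simp)
  have hq_le : ∀ A, MeasurableSet A → q A ≤ V A := fun A hA =>
    le_of_tendsto (hq A) (Eventually.of_forall fun n => hP n A hA)
  have hq_union : ∀ A B, MeasurableSet B → Disjoint A B → q (A ∪ B) = q A + q B := by
    intro A B hB hAB
    refine tendsto_nhds_unique (hq (A ∪ B)) ?_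
    simpa only [measure_union hAB hB] using (hq A).add (hq B)
  have hq_iUnion : ∀ f : ℕ → Set Ω, (∀ i, MeasurableSet (f i)) →
      Pairwise (Function.onFun Disjoint f) → q (⋃ i, f i) = ∑' i, q (f i) := by
    intro f hf hd
    -- Finite additivity survives the limit, so countable additivity reduces to `q (R n) → 0`. The
    -- tails decrease to ∅ and `q ≤ V`, so continuity gives this.
    set R : ℕ → Set Ω := fun n => ⋃ i ≥ n, f i with hR
    have hRm : ∀ n, MeasurableSet (R n) := fun n =>
      MeasurableSet.iUnion fun i => MeasurableSet.iUnion fun _ => hf i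
    have hR_succ : ∀ n, R n = f n ∪ R (n + 1) := by
      intro n
      ext x
      simp only [hR, Set.mem_iUnion, Set.mem_union, exists_prop]
      constructor
      · rintro ⟨i, hi, hx⟩
        rcases eq_or_lt_of_le hi with rfl | h
        · exact Or.inl hx
        · exact Or.inr ⟨i, h, hx⟩
      · rintro (hx | ⟨i, hi, hx⟩)
        · exact ⟨n, le_rfl, hx⟩
        · exact ⟨i, (Nat.le_succ n).trans hi, hx⟩
    have hR_disj : ∀ n, Disjoint (f n) (R (n + 1)) := by
      intro n
      simp only [hR, Set.disjoint_iUnion_right]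
      exact fun i hi => hd (Nat.ne_of_lt hi)
    have hsplit : ∀ n, q (⋃ i, f i) = ∑ i ∈ Finset.range n, q (f i) + q (R n) := by
      intro n
      induction n with
      | zero => simp [hR]
      | succ n ih =>
        rw [ih, hR_succ n, hq_union _ _ (hRm _) (hR_disj n), Finset.sum_range_succ, add_assoc]
    have hR_anti : Antitone R := antitone_nat_of_succ_le fun n => by
      rw [hR_succ n]
      exact Set.subset_union_right
    have hR_empty : ⋂ n, R n = ∅ := by
      refine Set.eq_empty_of_forall_notMem fun x hx => ?_
      rw [Set.mem_iInter] at hx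
      obtain ⟨i, -, hxi⟩ := Set.mem_iUnion₂.1 (hx 0)
      obtain ⟨j, hj, hxj⟩ := Set.mem_iUnion₂.1 (hx (i + 1))
      exact Set.disjoint_left.1 (hd (Nat.ne_of_lt hj)) hxi hxj
    have hR_zero : Tendsto (fun n => q (R n)) atTop (𝓝 0) :=
      tendsto_of_tendsto_of_tendsto_of_le_of_le tendsto_const_nhds (hV R hRm hR_anti hR_empty)
        (fun _ => zero_le) fun n => hq_le _ (hRm n)
    have h := (ENNReal.tendsto_nat_tsum fun i => q (f i)).add hR_zero
    simp only [← hsplit, add_zero] at h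
    exact tendsto_nhds_unique tendsto_const_nhds h
  set μ : Measure Ω := Measure.ofMeasurable (fun A _ => q A) hq_empty hq_iUnion with hμ
  have hμ_apply : ∀ A, MeasurableSet A → μ A = q A := fun A hA =>
    Measure.ofMeasurable_apply A hA
  have hprob : IsProbabilityMeasure μ := ⟨by rw [hμ_apply _ MeasurableSet.univ, hq_univ]⟩
  refine ⟨⟨μ, hprob⟩, fun A hA => ?_, fun A hA => ?_⟩
  · simpa [hμ_apply A hA] using hq_le A hA
  · simpa [hμ_apply A hA] using hq A

theorem apply_preimage_iterate {T : Ω → Ω} (hT : Measurable T) (hinv : IsInvariant T V) (k : ℕ)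
    {A : Set Ω} (hA : MeasurableSet A) : V (T^[k] ⁻¹' A) = V A := by
  induction k with
  | zero => simp
  | succ k ih =>
    rw [Function.iterate_succ, Set.preimage_comp, ← hinv _ (hT.iterate k hA), ih]

/-- The average of the images of `P` under the first `n + 1` iterates of `T`. -/
noncomputable def orbitAverage (T : Ω → Ω) (P : Measure Ω) (n : ℕ) : Measure Ω :=
  ((n : ℝ≥0∞) + 1)⁻¹ • ∑ k ∈ Finset.range (n + 1), P.map T^[k]

theorem orbitAverage_apply {T : Ω → Ω} (hT : Measurable T) (P : Measure Ω) (n : ℕ) {A : Set Ω}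
    (hA : MeasurableSet A) :
    orbitAverage T P n A = ((n : ℝ≥0∞) + 1)⁻¹ * ∑ k ∈ Finset.range (n + 1), P (T^[k] ⁻¹' A) := by
  simp [orbitAverage, Measure.map_apply (hT.iterate _) hA]

theorem inv_natCast_add_one_mul_cancel (n : ℕ) (a : ℝ≥0∞) :
    ((n : ℝ≥0∞) + 1)⁻¹ * (((n : ℝ≥0∞) + 1) * a) = a := by
  rw [← mul_assoc, ENNReal.inv_mul_cancel (by simp) (by finiteness), one_mul]

theorem orbitAverage_apply_of_preimage_eq {T : Ω → Ω} (hT : Measurable T) (P : Measure Ω) (n : ℕ)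
    {A : Set Ω} (hA : MeasurableSet A) (hTA : T ⁻¹' A = A) : orbitAverage T P n A = P A := by
  simp [orbitAverage_apply hT P n hA, preimage_iterate_eq_self hTA, inv_natCast_add_one_mul_cancel]

theorem orbitAverage_le {T : Ω → Ω} (hT : Measurable T) (hinv : IsInvariant T V) {P : Measure Ω}
    (hP : ∀ A, MeasurableSet A → P A ≤ V A) (n : ℕ) {A : Set Ω} (hA : MeasurableSet A) :
    orbitAverage T P n A ≤ V A := by
  rw [orbitAverage_apply hT P n hA]
  have h : ∑ k ∈ Finset.range (n + 1), P (T^[k] ⁻¹' A) ≤ ((n : ℝ≥0∞) + 1) * V A := by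
    refine (Finset.sum_le_card_nsmul _ _ (V A) fun k _ => ?_).trans (by simp)
    exact (hP _ (hT.iterate k hA)).trans (apply_preimage_iterate hT hinv k hA).le
  calc _ ≤ ((n : ℝ≥0∞) + 1)⁻¹ * (((n : ℝ≥0∞) + 1) * V A) := by gcongr
    _ = V A := inv_natCast_add_one_mul_cancel n _

/-- The two sums telescope, leaving end terms of weight 1/(n+1) that vanish in the limit. Both sides
are sums because subtraction in `ℝ≥0∞` truncates. -/
theorem orbitAverage_preimage_add {T : Ω → Ω} (hT : Measurable T) (P : Measure Ω) (n : ℕ)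
    {A : Set Ω} (hA : MeasurableSet A) :
    orbitAverage T P n (T ⁻¹' A) + ((n : ℝ≥0∞) + 1)⁻¹ * P A =
      orbitAverage T P n A + ((n : ℝ≥0∞) + 1)⁻¹ * P (T^[n + 1] ⁻¹' A) := by
  rw [orbitAverage_apply hT P n hA, orbitAverage_apply hT P n (hT hA), ← mul_add, ← mul_add]
  have h := Finset.sum_range_succ' (fun k => P (T^[k] ⁻¹' A)) (n + 1)
  rw [Finset.sum_range_succ] at h
  simpa [Function.iterate_succ', Set.preimage_comp, ← Set.preimage_comp,
    ← Function.iterate_succ] using congrArg (fun x => ((n : ℝ≥0∞) + 1)⁻¹ * x) h.symm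

theorem tendsto_inv_natCast_add_one_mul {a : ℕ → ℝ≥0∞} (ha : ∀ n, a n ≤ 1) :
    Tendsto (fun n : ℕ => ((n : ℝ≥0∞) + 1)⁻¹ * a n) atTop (𝓝 0) := by
  have h : Tendsto (fun n : ℕ => ((n : ℝ≥0∞) + 1)⁻¹) atTop (𝓝 0) := by
    simpa using (tendsto_add_atTop_iff_nat 1).2 ENNReal.tendsto_inv_nat_nhds_zero
  exact tendsto_of_tendsto_of_tendsto_of_le_of_le tendsto_const_nhds h (fun _ => zero_le)
    fun n => mul_le_of_le_one_right' (ha n)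

/-- If an invariant set has probability close to `1` under probabilities dominated by a continuous
invariant set function, then it has probability `1` under an invariant one. -/
theorem exists_mem_invariantPart_apply_eq_one {T : Ω → Ω} (hT : Measurable T)
    (hV : IsContinuous V) (hinv : IsInvariant T V) {P : ℕ → ProbabilityMeasure Ω}
    (hP : ∀ n, P n ∈ dominated V) {A : Set Ω} (hA : MeasurableSet A) (hTA : T ⁻¹' A = A)
    (hPA : Tendsto (fun n => (P n : Measure Ω) A) atTop (𝓝 1)) :
    ∃ Q ∈ invariantPart T (dominated V), (Q : Measure Ω) A = 1 := by
  have hprob : ∀ n, IsProbabilityMeasure (orbitAverage T (P n : Measure Ω) n) := fun n =>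
    ⟨by rw [orbitAverage_apply_of_preimage_eq hT _ n MeasurableSet.univ rfl, measure_univ]⟩
  -- A single ultrafilter gives limits on all sets at once; refining `atTop`, it keeps the ordinary
  -- limits.
  set U : Ultrafilter ℕ := hyperfilter ℕ
  have hU : (U : Filter ℕ) ≤ atTop := Nat.hyperfilter_le_atTop
  obtain ⟨Q, hQ, hlim⟩ := exists_mem_dominated_tendsto hV U
    (fun n => ⟨orbitAverage T (P n : Measure Ω) n, hprob n⟩)
    (fun n B hB => orbitAverage_le hT hinv (hP n) n hB)
  simp only [ProbabilityMeasure.coe_mk] at hlim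
  refine ⟨Q, ⟨hQ, hT, Measure.ext fun B hB => ?_⟩, ?_⟩
  · rw [Measure.map_apply hT hB]
    have h₁ := (hlim _ (hT hB)).add ((tendsto_inv_natCast_add_one_mul
      fun n => prob_le_one (μ := (P n : Measure Ω)) (s := B)).mono_left hU)
    have h₂ := (hlim _ hB).add ((tendsto_inv_natCast_add_one_mul
      fun n => prob_le_one (μ := (P n : Measure Ω)) (s := T^[n + 1] ⁻¹' B)).mono_left hU)
    simp only [orbitAverage_preimage_add hT _ _ hB, add_zero] at h₁ h₂
    exact tendsto_nhds_unique h₁ h₂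
  · have h := hlim A hA
    simp only [orbitAverage_apply_of_preimage_eq hT _ _ hA hTA] at h
    exact tendsto_nhds_unique h (hPA.mono_left hU)

end Limits

/-! ### The maximal inequality and Birkhoff's theorem -/

section Birkhoff

variable {Ω : Type*}

/-- The maximum of the first `n + 1` nonempty Birkhoff sums of `f`. -/
noncomputable def maxBirkhoffSum (T : Ω → Ω) (f : Ω → ℝ) : ℕ → Ω → ℝ
  | 0 => f
  | n + 1 => fun ω => f ω + max 0 (maxBirkhoffSum T f n (T ω))

theorem maxBirkhoffSum_succ (T : Ω → Ω) (f : Ω → ℝ) (n : ℕ) (ω : Ω) :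
    maxBirkhoffSum T f (n + 1) ω = f ω + max 0 (maxBirkhoffSum T f n (T ω)) := rfl

theorem monotone_maxBirkhoffSum (T : Ω → Ω) (f : Ω → ℝ) (ω : Ω) :
    Monotone fun n => maxBirkhoffSum T f n ω := by
  refine monotone_nat_of_le_succ fun n => ?_
  induction n generalizing ω with
  | zero => simp [maxBirkhoffSum]
  | succ n ih =>
    rw [maxBirkhoffSum_succ T f n, maxBirkhoffSum_succ T f (n + 1)]
    gcongr
    exact ih (T ω)

theorem birkhoffSum_succ_le_maxBirkhoffSum (T : Ω → Ω) (f : Ω → ℝ) (n : ℕ) (ω : Ω) :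
    birkhoffSum T f (n + 1) ω ≤ maxBirkhoffSum T f n ω := by
  induction n generalizing ω with
  | zero => simp [maxBirkhoffSum]
  | succ n ih =>
    rw [birkhoffSum_succ', maxBirkhoffSum_succ]
    gcongr
    exact (ih (T ω)).trans (le_max_right _ _)

theorem abs_maxBirkhoffSum_le {f : Ω → ℝ} {C : ℝ} (T : Ω → Ω) (hf : ∀ ω, |f ω| ≤ C) (n : ℕ)
    (ω : Ω) : |maxBirkhoffSum T f n ω| ≤ (n + 1) * C := by
  have hC : 0 ≤ C := (abs_nonneg _).trans (hf ω)
  induction n generalizing ω with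
  | zero => simpa [maxBirkhoffSum] using hf ω
  | succ n ih =>
    rw [maxBirkhoffSum_succ]
    have h₁ := abs_le.1 (hf ω)
    have h₂ := abs_le.1 (ih (T ω))
    have h₃ : max 0 (maxBirkhoffSum T f n (T ω)) ≤ (n + 1) * C := max_le (by positivity) h₂.2
    have h₄ := le_max_left 0 (maxBirkhoffSum T f n (T ω))
    have h₅ : 0 ≤ (n + 1) * C := by positivity
    push_cast
    rw [abs_le]
    constructor <;> linarith

/-- The recursion relates the two sequences up to the finite number `f ω`. The set of boundedness is
thus strictly invariant, so ergodicity applies to it. -/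
theorem bddAbove_maxBirkhoffSum_comp_iff (T : Ω → Ω) (f : Ω → ℝ) (ω : Ω) :
    BddAbove (Set.range fun n => maxBirkhoffSum T f n (T ω)) ↔
      BddAbove (Set.range fun n => maxBirkhoffSum T f n ω) := by
  simp only [bddAbove_def, Set.forall_mem_range]
  constructor
  · rintro ⟨K, hK⟩
    refine ⟨f ω + max 0 K, fun n => (monotone_maxBirkhoffSum T f ω n.le_succ).trans ?_⟩
    dsimp only
    rw [Nat.succ_eq_add_one, maxBirkhoffSum_succ]
    gcongr
    exact hK n
  · rintro ⟨K, hK⟩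
    refine ⟨K - f ω, fun n => ?_⟩
    have h₁ := hK (n + 1)
    rw [maxBirkhoffSum_succ] at h₁
    have h₂ := le_max_right 0 (maxBirkhoffSum T f n (T ω))
    linarith

variable [MeasurableSpace Ω] {T : Ω → Ω} {μ : Measure Ω} {f : Ω → ℝ}

theorem measurable_maxBirkhoffSum (hT : Measurable T) (hf : Measurable f) (n : ℕ) :
    Measurable (maxBirkhoffSum T f n) := by
  induction n with
  | zero => exact hf
  | succ n ih => exact hf.add (measurable_const.max (ih.comp hT))

theorem measurableSet_bddAbove_maxBirkhoffSum (hT : Measurable T) (hf : Measurable f) :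
    MeasurableSet {ω | BddAbove (Set.range fun n => maxBirkhoffSum T f n ω)} :=
  measurableSet_bddAbove_range fun n => measurable_maxBirkhoffSum hT hf n

theorem integrable_of_abs_le [IsFiniteMeasure μ] (hf : Measurable f) {C : ℝ}
    (hC : ∀ ω, |f ω| ≤ C) : Integrable f μ :=
  Integrable.of_bound hf.aestronglyMeasurable C (ae_of_all _ hC)

/-- A form of the maximal ergodic theorem. -/
theorem setIntegral_nonneg_of_not_bddAbove [IsFiniteMeasure μ] (hT : MeasurePreserving T μ μ)
    (hf : Measurable f) {C : ℝ} (hC : ∀ ω, |f ω| ≤ C) :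
    0 ≤ ∫ ω in {ω | BddAbove (Set.range fun n => maxBirkhoffSum T f n ω)}ᶜ, f ω ∂μ := by
  set A : Set Ω := {ω | BddAbove (Set.range fun n => maxBirkhoffSum T f n ω)}ᶜ
  have hAm : MeasurableSet A := (measurableSet_bddAbove_maxBirkhoffSum hT.measurable hf).compl
  have hTA : T ⁻¹' A = A := by
    ext ω
    exact not_congr (bddAbove_maxBirkhoffSum_comp_iff T f ω)
  have hTr : MeasurePreserving T (μ.restrict A) (μ.restrict A) := by
    simpa only [hTA] using hT.restrict_preimage hAm
  set M := maxBirkhoffSum T f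
  have hMm : ∀ n, Measurable (M n) := measurable_maxBirkhoffSum hT.measurable hf
  have hMi : ∀ n, Integrable (M n) (μ.restrict A) := fun n =>
    integrable_of_abs_le (hMm n) (abs_maxBirkhoffSum_le T hC n)
  have hMTi : ∀ n, Integrable (fun ω => M n (T ω)) (μ.restrict A) := fun n =>
    integrable_of_abs_le ((hMm n).comp hT.measurable) fun ω => abs_maxBirkhoffSum_le T hC n (T ω)
  -- The integrand is `f` plus the negative part of `M n ∘ T`. That part is at most `C`, as `M n ≥
  -- f`, and on `A` it is eventually zero. By invariance the integrals equal those of `M (n + 1) - M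
  -- n ≥ 0`.
  have hlim : Tendsto (fun n => ∫ ω in A, (M (n + 1) ω - M n (T ω)) ∂μ) atTop
      (𝓝 (∫ ω in A, f ω ∂μ)) := by
    refine tendsto_integral_of_dominated_convergence (fun _ => 2 * C)
      (fun n => ((hMi _).sub (hMTi _)).aestronglyMeasurable) (integrable_const _)
      (fun n => ae_of_all _ fun ω => ?_) ?_
    · have h₁ := abs_le.1 (hC ω)
      have h₂ := abs_le.1 (hC (T ω))
      have h₃ : f (T ω) ≤ M n (T ω) := monotone_maxBirkhoffSum T f (T ω) (Nat.zero_le n)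
      have h₄ : M (n + 1) ω = f ω + max 0 (M n (T ω)) := maxBirkhoffSum_succ T f n ω
      rw [Real.norm_eq_abs, h₄, abs_le]
      rcases max_cases 0 (M n (T ω)) with ⟨h, h'⟩ | ⟨h, h'⟩ <;> rw [h] <;> constructor <;> linarith
    · refine (ae_restrict_iff' hAm).2 (ae_of_all _ fun ω hω => ?_)
      have hω' : T ω ∈ A := by rwa [← hTA] at hω
      obtain ⟨_, ⟨N, rfl⟩, hN⟩ := not_bddAbove_iff.1 hω' 0
      refine tendsto_const_nhds.congr' ?_
      filter_upwards [eventually_ge_atTop N] with n hn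
      have h₁ : 0 ≤ M n (T ω) := hN.le.trans (monotone_maxBirkhoffSum T f (T ω) hn)
      have h₂ : M (n + 1) ω = f ω + max 0 (M n (T ω)) := maxBirkhoffSum_succ T f n ω
      rw [h₂, max_eq_right h₁]
      ring
  refine ge_of_tendsto' hlim fun n => ?_
  have h : ∫ ω in A, M n (T ω) ∂μ = ∫ ω in A, M n ω ∂μ := by
    conv_rhs => rw [← hTr.map_eq]
    rw [integral_map hT.measurable.aemeasurable (hMm n).aestronglyMeasurable]
  rw [integral_sub (hMi _) (hMTi _), h, sub_nonneg]
  exact integral_mono (hMi _) (hMi _) fun ω => monotone_maxBirkhoffSum T f ω n.le_succ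

theorem ae_bddAbove_maxBirkhoffSum [IsFiniteMeasure μ] (hT : Ergodic T μ) (hf : Measurable f)
    {C : ℝ} (hC : ∀ ω, |f ω| ≤ C) (hint : ∫ ω, f ω ∂μ < 0) :
    ∀ᵐ ω ∂μ, BddAbove (Set.range fun n => maxBirkhoffSum T f n ω) := by
  set A : Set Ω := {ω | BddAbove (Set.range fun n => maxBirkhoffSum T f n ω)}
  have hAm : MeasurableSet A := measurableSet_bddAbove_maxBirkhoffSum hT.measurable hf
  have hTA : T ⁻¹' A = A := Set.ext fun ω => bddAbove_maxBirkhoffSum_comp_iff T f ω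
  rcases hT.ae_mem_or_ae_notMem hAm hTA with h | h
  · exact h
  · have h₁ : 0 ≤ ∫ ω in Aᶜ, f ω ∂μ :=
      setIntegral_nonneg_of_not_bddAbove hT.toMeasurePreserving hf hC
    rw [Measure.restrict_eq_self_of_ae_mem (s := Aᶜ) h] at h₁
    exact absurd hint h₁.not_gt

theorem ae_eventually_average_le [IsProbabilityMeasure μ] (hT : Ergodic T μ) (hf : Measurable f)
    {C : ℝ} (hC : ∀ ω, |f ω| ≤ C) {c : ℝ} (hc : ∫ ω, f ω ∂μ < c) :
    ∀ᵐ ω ∂μ, ∀ᶠ n : ℕ in atTop, (1 / (n : ℝ)) * ∑ k ∈ Finset.range n, f (T^[k] ω) < c := by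
  -- Since `f - b` has negative mean, its Birkhoff sums are a.e. bounded above by some `K`. The
  -- averages of `f` are then at most `b + K / n`, which is eventually below `c`.
  obtain ⟨b, hb, hbc⟩ := exists_between hc
  have hC' : ∀ ω, |f ω - b| ≤ C + |b| := fun ω =>
    (abs_sub _ _).trans (add_le_add_left (hC ω) _)
  have hint : ∫ ω, (f ω - b) ∂μ < 0 := by
    rw [integral_sub (integrable_of_abs_le hf hC) (integrable_const _)]
    simpa using hb
  filter_upwards [ae_bddAbove_maxBirkhoffSum hT (hf.sub_const b) hC' hint] with ω ⟨K, hK⟩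
  have hlim : Tendsto (fun n : ℕ => b + K / (n : ℝ)) atTop (𝓝 (b + 0)) :=
    tendsto_const_nhds.add (tendsto_const_div_atTop_nhds_zero_nat K)
  rw [add_zero] at hlim
  filter_upwards [hlim.eventually_lt_const hbc, eventually_gt_atTop 0] with n hn hn₀
  refine lt_of_le_of_lt ?_ hn
  obtain ⟨m, rfl⟩ := Nat.exists_eq_add_of_lt hn₀
  have h := (birkhoffSum_succ_le_maxBirkhoffSum T (fun ω => f ω - b) m ω).trans
    (hK (Set.mem_range_self m))
  simp only [birkhoffSum, Finset.sum_sub_distrib, Finset.sum_const, Finset.card_range,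
    nsmul_eq_mul] at h
  simp only [zero_add]
  have hpos : (0 : ℝ) < ((m + 1 : ℕ) : ℝ) := by positivity
  rw [one_div_mul_eq_div, div_le_iff₀ hpos, add_mul, div_mul_cancel₀ _ hpos.ne']
  linarith

/-- Birkhoff's pointwise ergodic theorem for bounded functions and ergodic maps. -/
theorem ae_tendsto_average [IsProbabilityMeasure μ] (hT : Ergodic T μ) (hf : Measurable f)
    {C : ℝ} (hC : ∀ ω, |f ω| ≤ C) :
    ∀ᵐ ω ∂μ, Tendsto (fun n : ℕ => (1 / (n : ℝ)) * ∑ k ∈ Finset.range n, f (T^[k] ω)) atTop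
      (𝓝 (∫ ω, f ω ∂μ)) := by
  have hpos : ∀ m : ℕ, 0 < 1 / ((m : ℝ) + 1) := fun m => Nat.one_div_pos_of_nat
  have hup : ∀ᵐ ω ∂μ, ∀ m : ℕ, ∀ᶠ n : ℕ in atTop,
      (1 / (n : ℝ)) * ∑ k ∈ Finset.range n, f (T^[k] ω) < ∫ ω, f ω ∂μ + 1 / ((m : ℝ) + 1) :=
    ae_all_iff.2 fun m => ae_eventually_average_le hT hf hC (lt_add_of_pos_right _ (hpos m))
  have hlow : ∀ᵐ ω ∂μ, ∀ m : ℕ, ∀ᶠ n : ℕ in atTop,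
      (1 / (n : ℝ)) * ∑ k ∈ Finset.range n, -f (T^[k] ω) <
        ∫ ω, -f ω ∂μ + 1 / ((m : ℝ) + 1) :=
    ae_all_iff.2 fun m => ae_eventually_average_le hT hf.neg (C := C) (by simpa using hC)
      (lt_add_of_pos_right _ (hpos m))
  filter_upwards [hup, hlow] with ω h₁ h₂
  refine Metric.tendsto_atTop'.2 fun ε hε => ?_
  obtain ⟨m, hm⟩ := exists_nat_one_div_lt hε
  obtain ⟨N, hN⟩ := eventually_atTop.1 ((h₁ m).and (h₂ m))
  refine ⟨N, fun n hn => ?_⟩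
  obtain ⟨h₃, h₄⟩ := hN n hn.le
  rw [integral_neg, Finset.sum_neg_distrib, mul_neg] at h₄
  rw [Real.dist_eq, abs_lt]
  constructor <;> linarith

end Birkhoff

/-! ### Finite decomposition into atoms -/

section Atoms

variable {Ω : Type*} [MeasurableSpace Ω] {Θ : Set (ProbabilityMeasure Ω)} {T : Ω → Ω}

theorem le_upperProb {P : ProbabilityMeasure Ω} (hP : P ∈ Θ) (A : Set Ω) :
    (P : Measure Ω) A ≤ upperProb Θ A :=
  le_iSup₂ (f := fun (P : ProbabilityMeasure Ω) (_ : P ∈ Θ) => (P : Measure Ω) A) P hP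

theorem upperProb_mono {A B : Set Ω} (h : A ⊆ B) : upperProb Θ A ≤ upperProb Θ B :=
  iSup₂_mono fun _ _ => measure_mono h

theorem apply_eq_zero_of_upperProb_eq_zero {P : ProbabilityMeasure Ω} (hP : P ∈ Θ) {A : Set Ω}
    (hA : upperProb Θ A = 0) : (P : Measure Ω) A = 0 :=
  le_antisymm (hA ▸ le_upperProb hP A) zero_le

theorem upperProb_univ (hΘ : Θ.Nonempty) : upperProb Θ Set.univ = 1 := by
  obtain ⟨P, hP⟩ := hΘ
  exact le_antisymm (iSup₂_le fun Q _ => prob_le_one) (by simpa using le_upperProb hP Set.univ)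

/-- An invariant set of positive capacity that cannot be split into two invariant sets of positive
capacity. -/
structure IsAtom (T : Ω → Ω) (V : Set Ω → ℝ≥0∞) (A : Set Ω) : Prop where
  measurableSet : MeasurableSet[MeasurableSpace.invariants T] A
  ne_zero : V A ≠ 0
  eq_zero_or : ∀ B, MeasurableSet[MeasurableSpace.invariants T] B → B ⊆ A →
    V B = 0 ∨ V (A \ B) = 0

/-- There is no infinite decreasing chain of invariant sets whose successive differences have
positive capacity. -/
theorem wellFounded_upperProb_diff (hV : IsContinuous (upperProb Θ))
    (h01 : IsZeroOne T (upperProb Θ)) :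
    WellFounded fun B A : {A : Set Ω // MeasurableSet[MeasurableSpace.invariants T] A} =>
      (B : Set Ω) ⊆ A ∧ upperProb Θ ((A : Set Ω) \ B) ≠ 0 := by
  refine wellFounded_iff_isEmpty_descending_chain.2 ⟨fun ⟨A, hA⟩ => ?_⟩
  have hAm : ∀ n, MeasurableSet (A n : Set Ω) := fun n => (A n).2.1
  have hanti : Antitone fun n => (A n : Set Ω) := antitone_nat_of_succ_le fun n => (hA n).1
  have hlim := hV (fun n => (A n : Set Ω) \ ⋂ k, (A k : Set Ω))
    (fun n => (hAm n).diff (MeasurableSet.iInter hAm))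
    (fun m n h => Set.sdiff_subset_sdiff_left (hanti h))
    (by
      refine Set.eq_empty_of_forall_notMem fun x hx => ?_
      rw [Set.mem_iInter] at hx
      exact (hx 0).2 (Set.mem_iInter.2 fun n => (hx n).1))
  -- `A n \ A (n + 1)` is invariant of positive capacity, hence of capacity 1.
  have hge : ∀ n, 1 ≤ upperProb Θ ((A n : Set Ω) \ ⋂ k, (A k : Set Ω)) := fun n => by
    rw [← (h01 _ ((A n).2.diff (A (n + 1)).2)).resolve_left (hA n).2]
    exact upperProb_mono (Set.sdiff_subset_sdiff_right (Set.iInter_subset _ _))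
  exact absurd (ge_of_tendsto' hlim hge) (by simp)

-- Well-founded induction: a set that is not an atom splits into two invariant parts of positive
-- capacity. Each part lies below it in the order, because the other part is what was removed.
open Classical in
theorem exists_finset_isAtom (hV : IsContinuous (upperProb Θ)) (h01 : IsZeroOne T (upperProb Θ))
    {A : Set Ω} (hA : MeasurableSet[MeasurableSpace.invariants T] A) (hA₀ : upperProb Θ A ≠ 0) :
    ∃ F : Finset (Set Ω), (∀ B ∈ F, IsAtom T (upperProb Θ) B) ∧
      (F : Set (Set Ω)).PairwiseDisjoint id ∧ ⋃₀ (F : Set (Set Ω)) = A := by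
  suffices h : ∀ A : {A : Set Ω // MeasurableSet[MeasurableSpace.invariants T] A},
      upperProb Θ A ≠ 0 → ∃ F : Finset (Set Ω), (∀ B ∈ F, IsAtom T (upperProb Θ) B) ∧
      (F : Set (Set Ω)).PairwiseDisjoint id ∧ ⋃₀ (F : Set (Set Ω)) = A from h ⟨A, hA⟩ hA₀
  intro A
  induction A using (wellFounded_upperProb_diff hV h01).induction with
  | _ A ih =>
  intro hA₀
  by_cases hAt : IsAtom T (upperProb Θ) (A : Set Ω)
  · exact ⟨{(A : Set Ω)}, by simpa using hAt, by simp, by simp⟩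
  obtain ⟨B, hB, hBA, hB₀, hAB₀⟩ : ∃ B, MeasurableSet[MeasurableSpace.invariants T] B ∧
      B ⊆ (A : Set Ω) ∧ upperProb Θ B ≠ 0 ∧ upperProb Θ ((A : Set Ω) \ B) ≠ 0 := by
    by_contra! h
    exact hAt ⟨A.2, hA₀, fun B hB hBA => or_iff_not_imp_left.2 (h B hB hBA)⟩
  obtain ⟨F, hF, hFd, hFu⟩ := ih ⟨B, hB⟩ ⟨hBA, hAB₀⟩ hB₀
  obtain ⟨G, hG, hGd, hGu⟩ := ih ⟨(A : Set Ω) \ B, A.2.diff hB⟩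
    ⟨Set.sdiff_subset, by simpa [Set.inter_eq_right.2 hBA] using hB₀⟩ hAB₀
  dsimp only at hFu hGu
  refine ⟨F ∪ G, fun C hC => (Finset.mem_union.1 hC).elim (hF C) (hG C), ?_, ?_⟩
  · rw [Finset.coe_union, Set.pairwiseDisjoint_union]
    refine ⟨hFd, hGd, fun C hC D hD _ => ?_⟩
    refine Set.disjoint_of_subset (s₂ := B) (t₂ := (A : Set Ω) \ B) ?_ ?_ Set.disjoint_sdiff_right
    · exact hFu ▸ Set.subset_sUnion_of_mem hC
    · exact hGu ▸ Set.subset_sUnion_of_mem hD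
  · rw [Finset.coe_union, Set.sUnion_union, hFu, hGu, Set.union_sdiff_cancel hBA]

/-- An invariant set cuts `D` into two parts, one of which has capacity zero and so is null for `P`,
which lives on `D`. -/
theorem IsAtom.ergodic {D : Set Ω} (hD : IsAtom T (upperProb Θ) D) {P : ProbabilityMeasure Ω}
    (hP : P ∈ invariantPart T Θ) (hPD : (P : Measure Ω) D = 1) : Ergodic T (P : Measure Ω) := by
  refine ⟨hP.2, ⟨fun {A} hA hTA => ?_⟩⟩
  have hDae : ∀ᵐ ω ∂(P : Measure Ω), ω ∈ D := (prob_compl_eq_zero_iff hD.measurableSet.1).2 hPD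
  have hA' : MeasurableSet[MeasurableSpace.invariants T] A := ⟨hA, hTA⟩
  rw [eventuallyConst_set]
  rcases hD.eq_zero_or (D ∩ A) (hD.measurableSet.inter hA') Set.inter_subset_left with h | h
  · right
    have h₀ := measure_eq_zero_iff_ae_notMem.1 (apply_eq_zero_of_upperProb_eq_zero hP.1 h)
    filter_upwards [hDae, h₀] with ω h₁ h₂ h₃ using h₂ ⟨h₁, h₃⟩
  · left
    have h₀ := measure_eq_zero_iff_ae_notMem.1 (apply_eq_zero_of_upperProb_eq_zero hP.1 h)
    filter_upwards [hDae, h₀] with ω h₁ h₂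
    by_contra h₃
    exact h₂ ⟨h₁, fun h => h₃ h.2⟩

theorem exists_mem_invariantPart (hT : Measurable T) (hΘ : Θ = dominated (upperProb Θ))
    (hV : IsErgodic T (upperProb Θ)) {A : Set Ω}
    (hA : MeasurableSet[MeasurableSpace.invariants T] A) (hA₁ : upperProb Θ A = 1) :
    ∃ P ∈ invariantPart T Θ, (P : Measure Ω) A = 1 := by
  have h : ∀ n : ℕ, ∃ P ∈ Θ, 1 - ((n : ℝ≥0∞) + 1)⁻¹ < (P : Measure Ω) A := by
    intro n
    have hlt : 1 - ((n : ℝ≥0∞) + 1)⁻¹ < upperProb Θ A := by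
      rw [hA₁]
      exact ENNReal.sub_lt_self (by simp) (by simp) (by simp)
    simpa [upperProb, lt_iSup_iff] using hlt
  choose P hPΘ hPA using h
  have hP : ∀ n, P n ∈ dominated (upperProb Θ) := fun n => hΘ ▸ hPΘ n
  have hlim : Tendsto (fun n => (P n : Measure Ω) A) atTop (𝓝 1) := by
    have h₀ : Tendsto (fun n : ℕ => 1 - ((n : ℝ≥0∞) + 1)⁻¹) atTop (𝓝 (1 - 0)) := by
      refine ENNReal.Tendsto.sub tendsto_const_nhds ?_ (by simp)
      simpa using tendsto_inv_natCast_add_one_mul (a := fun _ => 1) fun _ => le_rfl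
    rw [tsub_zero] at h₀
    exact tendsto_of_tendsto_of_tendsto_of_le_of_le h₀ tendsto_const_nhds
      (fun n => (hPA n).le) fun n => prob_le_one
  rw [hΘ]
  exact exists_mem_invariantPart_apply_eq_one hT hV.continuous hV.invariant hP hA.1 hA.2 hlim

end Atoms

/-! ### Transfer of convergence to all members of the family -/

section Averages

variable {Ω : Type*} {T : Ω → Ω} {ξ : Ω → ℝ}

theorem tendsto_average_comp_iff {C : ℝ} (hC : ∀ ω, |ξ ω| ≤ C) (ω : Ω) (l : ℝ) :
    Tendsto (fun n : ℕ => (1 / (n : ℝ)) * ∑ k ∈ Finset.range n, ξ (T^[k] (T ω))) atTop (𝓝 l) ↔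
      Tendsto (fun n : ℕ => (1 / (n : ℝ)) * ∑ k ∈ Finset.range n, ξ (T^[k] ω)) atTop (𝓝 l) := by
  have h : Tendsto (fun n : ℕ => (1 / (n : ℝ)) * ∑ k ∈ Finset.range n, ξ (T^[k] (T ω)) -
      (1 / (n : ℝ)) * ∑ k ∈ Finset.range n, ξ (T^[k] ω)) atTop (𝓝 0) := by
    -- After telescoping, the difference is `(ξ (T^[n] ω) - ξ ω) / n`.
    refine squeeze_zero_norm (fun n => ?_) (tendsto_const_div_atTop_nhds_zero_nat (2 * C))
    have h₁ := Finset.sum_range_succ' (fun k => ξ (T^[k] ω)) n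
    rw [Finset.sum_range_succ] at h₁
    simp only [Function.iterate_succ, Function.comp_apply, Function.iterate_zero, id] at h₁
    rw [← mul_sub, norm_mul, Real.norm_eq_abs, Real.norm_eq_abs,
      abs_of_nonneg (by positivity : (0 : ℝ) ≤ 1 / n), one_div_mul_eq_div]
    gcongr
    have h₂ := abs_le.1 (hC ω)
    have h₃ := abs_le.1 (hC (T^[n] ω))
    rw [abs_le]
    constructor <;> linarith
  constructor
  · intro h'
    simpa using h'.sub h
  · intro h'
    simpa using h'.add h

variable [MeasurableSpace Ω]

theorem measurableSet_invariants_tendsto_average (hT : Measurable T) (hξ : Measurable ξ) {C : ℝ}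
    (hC : ∀ ω, |ξ ω| ≤ C) (l : ℝ) :
    MeasurableSet[MeasurableSpace.invariants T] {ω | Tendsto
      (fun n : ℕ => (1 / (n : ℝ)) * ∑ k ∈ Finset.range n, ξ (T^[k] ω)) atTop (𝓝 l)} := by
  refine ⟨measurableSet_tendsto (𝓝 l) fun n => ?_,
    Set.ext fun ω => tendsto_average_comp_iff hC ω l⟩
  exact (Finset.measurable_fun_sum _ fun k _ => hξ.comp (hT.iterate k)).const_mul _

theorem integral_le_upperExp {Θ : Set (ProbabilityMeasure Ω)} {P : ProbabilityMeasure Ω}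
    (hP : P ∈ Θ) {C : ℝ} (hC : ∀ ω, |ξ ω| ≤ C) :
    ∫ ω, ξ ω ∂(P : Measure Ω) ≤ upperExp Θ ξ := by
  refine le_csSup ⟨C, ?_⟩ (Set.mem_image_of_mem _ hP)
  rintro _ ⟨Q, -, rfl⟩
  refine (le_abs_self _).trans ?_
  simpa using norm_integral_le_of_norm_le_const (μ := (Q : Measure Ω)) (f := ξ) (ae_of_all _ hC)

/-- The averages of a bounded function converge to the same constant almost everywhere on an atom
under every member of the family. -/
theorem IsAtom.ae_tendsto_average {Θ : Set (ProbabilityMeasure Ω)} {D : Set Ω}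
    (hD : IsAtom T (upperProb Θ) D) {P Q : ProbabilityMeasure Ω} (hP : P ∈ invariantPart T Θ)
    (hPD : (P : Measure Ω) D = 1) (hQ : Q ∈ Θ) (hξ : Measurable ξ) {C : ℝ}
    (hC : ∀ ω, |ξ ω| ≤ C) :
    ∀ᵐ ω ∂(Q : Measure Ω), ω ∈ D → Tendsto
      (fun n : ℕ => (1 / (n : ℝ)) * ∑ k ∈ Finset.range n, ξ (T^[k] ω)) atTop
      (𝓝 (∫ ω, ξ ω ∂(P : Measure Ω))) := by
  set G : Set Ω := {ω | Tendsto
      (fun n : ℕ => (1 / (n : ℝ)) * ∑ k ∈ Finset.range n, ξ (T^[k] ω)) atTop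
      (𝓝 (∫ ω, ξ ω ∂(P : Measure Ω)))}
  have hGm : MeasurableSet[MeasurableSpace.invariants T] G :=
    measurableSet_invariants_tendsto_average hP.2.measurable hξ hC _
  have hDG : upperProb Θ (D \ (D ∩ G)) = 0 := by
    refine (hD.eq_zero_or (D ∩ G) (hD.measurableSet.inter hGm) Set.inter_subset_left).resolve_left
      fun h => ?_
    have h₁ := measure_eq_zero_iff_ae_notMem.1 (apply_eq_zero_of_upperProb_eq_zero hP.1 h)
    have hDae : ∀ᵐ ω ∂(P : Measure Ω), ω ∈ D :=
      (prob_compl_eq_zero_iff hD.measurableSet.1).2 hPD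
    have hfalse : ∀ᵐ ω ∂(P : Measure Ω), False := by
      filter_upwards [h₁, hDae, ErgodicCapacity.ae_tendsto_average (hD.ergodic hP hPD) hξ hC]
        with ω h₂ h₃ h₄ using h₂ ⟨h₃, h₄⟩
    exact hfalse.exists.elim fun _ h => h
  filter_upwards [measure_eq_zero_iff_ae_notMem.1 (apply_eq_zero_of_upperProb_eq_zero hQ hDG)]
    with ω h₁ h₂
  by_contra h₃
  exact h₁ ⟨h₂, fun h => h₃ h.2⟩

/-- An atom carries at most one invariant member of the family. -/
theorem IsAtom.eq_of_mem_invariantPart {Θ : Set (ProbabilityMeasure Ω)} {D : Set Ω}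
    (hD : IsAtom T (upperProb Θ) D) {P Q : ProbabilityMeasure Ω}
    (hP : P ∈ invariantPart T Θ) (hQ : Q ∈ invariantPart T Θ) (hPD : (P : Measure Ω) D = 1)
    (hQD : (Q : Measure Ω) D = 1) : P = Q := by
  refine Subtype.ext (Measure.ext fun B hB => ?_)
  have hξ : Measurable (B.indicator fun _ => (1 : ℝ)) := measurable_const.indicator hB
  have hC : ∀ ω, |B.indicator (fun _ => (1 : ℝ)) ω| ≤ 1 := fun ω => by
    by_cases h : ω ∈ B <;> simp [h]
  have hDae : ∀ᵐ ω ∂(Q : Measure Ω), ω ∈ D := (prob_compl_eq_zero_iff hD.measurableSet.1).2 hQD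
  -- `Q`-a.e. the visit frequencies to `B` tend to `P B`, by transfer from the atom, and to `Q B`,
  -- by Birkhoff's theorem for `Q`.
  have h : ∀ᵐ ω ∂(Q : Measure Ω), ∫ ω, B.indicator (fun _ => (1 : ℝ)) ω ∂(P : Measure Ω) =
      ∫ ω, B.indicator (fun _ => (1 : ℝ)) ω ∂(Q : Measure Ω) := by
    filter_upwards [hDae, hD.ae_tendsto_average hP hPD hQ.1 hξ hC,
      ErgodicCapacity.ae_tendsto_average (hD.ergodic hQ hQD) hξ hC] with ω h₁ h₂ h₃
    exact tendsto_nhds_unique (h₂ h₁) h₃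
  obtain ⟨-, h⟩ := h.exists
  simp only [integral_indicator_const _ hB, smul_eq_mul, mul_one] at h
  have hfin (R : ProbabilityMeasure Ω) : (R : Measure Ω) B ≠ ∞ := measure_ne_top _ _
  exact (measureReal_eq_measureReal_iff (hfin P) (hfin Q)).1 h

end Averages

end ErgodicCapacity

/-! ### Ergodic members and limits read off the atoms -/

theorem theorem3p2 {Ω : Type*} [MeasurableSpace Ω] (T : Ω → Ω) (hT : Measurable T)
    (Θ : Set (ProbabilityMeasure Ω)) (hne : Θ.Nonempty)
    (hΘ : Θ = ErgodicCapacity.dominated (ErgodicCapacity.upperProb Θ))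
    (hV : ErgodicCapacity.IsErgodic T (ErgodicCapacity.upperProb Θ)) :
    (ErgodicCapacity.invariantPart T Θ).Nonempty ∧
    ∃ (m : ℕ) (p : Fin m → ProbabilityMeasure Ω) (D : Fin m → Set Ω),
      Function.Injective p ∧
      Set.range p = ErgodicCapacity.ergodicPart T Θ ∧
      (∀ i, MeasurableSet[MeasurableSpace.invariants T] (D i)) ∧
      Pairwise (fun i j => Disjoint (D i) (D j)) ∧
      ⋃ i, D i = Set.univ ∧
      (∀ i, (p i : Measure Ω) (D i) = 1) ∧
      ∀ P ∈ Θ, ∀ ξ : Ω → ℝ, Measurable ξ → (∃ C : ℝ, ∀ ω, |ξ ω| ≤ C) →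
        ∀ᵐ ω ∂(P : Measure Ω), ∃ l : ℝ,
          Tendsto (fun n : ℕ => (1 / (n : ℝ)) * ∑ k ∈ Finset.range n, ξ (T^[k] ω))
            atTop (𝓝 l) ∧
          -ErgodicCapacity.upperExp (ErgodicCapacity.invariantPart T Θ) (fun ω' => -ξ ω') ≤ l ∧
          l ≤ ErgodicCapacity.upperExp (ErgodicCapacity.invariantPart T Θ) ξ ∧
          l = ∑ i, (∫ ω', ξ ω' ∂(p i : Measure Ω)) * (D i).indicator (fun _ => (1 : ℝ)) ω := by
  obtain ⟨P₀, hP₀, -⟩ := ErgodicCapacity.exists_mem_invariantPart hT hΘ hV (A := Set.univ)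
    MeasurableSet.univ (ErgodicCapacity.upperProb_univ hne)
  refine ⟨⟨P₀, hP₀⟩, ?_⟩
  obtain ⟨F, hF, hFd, hFu⟩ := ErgodicCapacity.exists_finset_isAtom (A := Set.univ) hV.continuous
    hV.zeroOne MeasurableSet.univ (by simp [ErgodicCapacity.upperProb_univ hne])
  set D : Fin F.card → Set Ω := fun i => F.equivFin.symm i with hD
  have hDF : ∀ i, D i ∈ F := fun i => (F.equivFin.symm i).2
  have hDat : ∀ i, ErgodicCapacity.IsAtom T (ErgodicCapacity.upperProb Θ) (D i) := fun i =>
    hF _ (hDF i)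
  have hDinj : Function.Injective D := Subtype.val_injective.comp F.equivFin.symm.injective
  have hDd : Pairwise fun i j => Disjoint (D i) (D j) := fun i j hij =>
    hFd (hDF i) (hDF j) (hDinj.ne hij)
  have hDu : ⋃ i, D i = Set.univ := by
    refine Set.eq_univ_of_forall fun ω => ?_
    obtain ⟨B, hB, hω⟩ := Set.mem_sUnion.1 (hFu.symm ▸ Set.mem_univ ω)
    exact Set.mem_iUnion.2 ⟨F.equivFin ⟨B, hB⟩, by simpa [hD] using hω⟩
  have hp : ∀ i, ∃ P ∈ ErgodicCapacity.invariantPart T Θ, (P : Measure Ω) (D i) = 1 := fun i =>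
    ErgodicCapacity.exists_mem_invariantPart hT hΘ hV (hDat i).measurableSet
      ((hV.zeroOne _ (hDat i).measurableSet).resolve_left (hDat i).ne_zero)
  choose p hpinv hpD using hp
  refine ⟨F.card, p, D, ?_, ?_, fun i => (hDat i).measurableSet, hDd, hDu, hpD, ?_⟩
  · intro i j hij
    by_contra hne
    -- If `p i = p j`, this probability would give mass 2 to `D i ∪ D j`.
    have h := measure_union (μ := (p i : Measure Ω)) (hDd hne) (hDat j).measurableSet.1
    rw [hpD i, hij, hpD j] at h
    exact absurd (h ▸ prob_le_one (μ := (p j : Measure Ω)) (s := D i ∪ D j)) (by norm_num)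
  · refine Set.Subset.antisymm ?_ fun Q hQ => ?_
    · rintro _ ⟨i, rfl⟩
      exact ⟨(hpinv i).1, (hDat i).ergodic (hpinv i) (hpD i)⟩
    · obtain ⟨i, hi⟩ : ∃ i, (Q : Measure Ω) (D i) ≠ 0 := by
        by_contra! h
        have h' := measure_iUnion_null h
        rw [hDu, measure_univ] at h'
        exact one_ne_zero h'
      have hQi := (hQ.2.prob_eq_zero_or_one (hDat i).measurableSet.1
        (hDat i).measurableSet.2).resolve_left hi
      exact ⟨i, (hDat i).eq_of_mem_invariantPart (hpinv i) ⟨hQ.1, hQ.2.toMeasurePreserving⟩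
        (hpD i) hQi⟩
  · rintro P hP ξ hξ ⟨C, hC⟩
    have h : ∀ᵐ ω ∂(P : Measure Ω), ∀ i, ω ∈ D i → Tendsto
        (fun n : ℕ => (1 / (n : ℝ)) * ∑ k ∈ Finset.range n, ξ (T^[k] ω)) atTop
        (𝓝 (∫ ω, ξ ω ∂(p i : Measure Ω))) :=
      ae_all_iff.2 fun i => (hDat i).ae_tendsto_average (hpinv i) (hpD i) hP hξ hC
    filter_upwards [h] with ω hω
    obtain ⟨i, hi⟩ := Set.mem_iUnion.1 (hDu.symm ▸ Set.mem_univ ω)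
    refine ⟨_, hω i hi, ?_, ErgodicCapacity.integral_le_upperExp (hpinv i) hC, ?_⟩
    · have h := ErgodicCapacity.integral_le_upperExp (ξ := fun ω => -ξ ω) (hpinv i)
        (C := C) (by simpa using hC)
      rw [integral_neg] at h
      linarith
    · rw [Finset.sum_eq_single i]
      · simp [hi]
      · intro j _ hji
        simp [Set.disjoint_right.1 (hDd hji) hi]
      · simp
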